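/- Let $F:\mathbb{R}^n\times\mathbb{R}^m\to\mathbb{R}$ be differentiable in each variable and suppose: 1. ($L$-smoothness) there is $L>0$ such that for all $x_1,x_2,y_1,y_2$, $\|\nabla_xF(x_1,y_1)-\nabla_xF(x_2,y_2)\|\le L\,(\|x_1-x_2\|+\|y_1-y_2\|)$ and $\|\nabla_yF(x_1,y_1)-\nabla_yF(x_2,y_2)\|\le L\,(\|x_1-x_2\|+\|y_1-y_2\|)$; 2. there is a point $(x^\star,y^\star)$ with $\nabla_xF(x^\star,y^\star)=0$ and $\nabla_yF(x^\star,y^\star)=0$; for every $y$ the function $F(\cdot,y)$ attains its minimum, and for every $x$ the function $F(x,\cdot)$ attains its maximum; 3. (two-sided Polyak–Łojasiewicz condition) there are $\mu_1,\mu_2>0$ such that for all $x,y$, $\tfrac12\|\nabla_xF(x,y)\|^2\ge\mu_1\,[F(x,y)-\min_{x'}F(x',y)]$ and $\tfrac12\|\nabla_yF(x,y)\|^2\ge\mu_2\,[\max_{y'}F(x,y')-F(x,y)]$. If $F$ does not depend on $x$, assume in addition $\mu_1\le L$; if $F$ does not depend on $y$, assume in addition $\mu_2\le L$ (otherwise these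 inequalities follow from 1–3). Let $h(x)=\max_yF(x,y)$, $h^*=\min_xh(x)$, $L_h=L+\frac{L^2}{2\mu_2}$ and $M=\max\left\{\frac{2L_h^2}{\mu_1},\frac{40L^2}{\mu_2}\right\}$. From an arbitrary $(x_0,y_0)$, let $$x_{k+1}=x_k-\alpha\nabla_xF(x_k,y_k),\qquad y_{k+1}=y_k+\beta\nabla_yF(x_{k+1},y_k),\qquad \alpha=\frac{\mu_2^2}{18L^3},\quad \beta=\frac1L ,$$ and put $a_k=h(x_k)-h^*$, $b_k=h(x_k)-F(x_k,y_k)$, $P_k=a_k+\frac1{10}b_k$. Then for every $k\ge1$, $$\|\nabla_xF(x_k,y_k)\|^2+\|\nabla_yF(x_k,y_k)\|^2\le P_0\,M\left(1-\frac{\mu_1\mu_2^2}{36L^3}\right)^{k}.$$ -/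

import Mathlib

noncomputable section

namespace Minimax

variable {n m : ℕ}

/-- The space `ℝⁿ` with the Euclidean norm. -/
abbrev Vec (n : ℕ) := EuclideanSpace ℝ (Fin n)

/-- The partial gradient `∇ₓ F(x, y)`. -/
def gradX (F : Vec n → Vec m → ℝ) (x : Vec n) (y : Vec m) : Vec n :=
  gradient (fun x' => F x' y) x

/-- The partial gradient `∇_y F(x, y)`. -/
def gradY (F : Vec n → Vec m → ℝ) (x : Vec n) (y : Vec m) : Vec m :=
  gradient (fun y' => F x y') y

/-- `F` has partial gradients everywhere and they are `L`-Lipschitz, with `L > 0`. -/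
structure LSmooth (F : Vec n → Vec m → ℝ) (L : ℝ) : Prop where
  pos : 0 < L
  diff_x : ∀ x y, DifferentiableAt ℝ (fun x' => F x' y) x
  diff_y : ∀ x y, DifferentiableAt ℝ (fun y' => F x y') y
  lip_x : ∀ x₁ x₂ y₁ y₂,
    ‖gradX F x₁ y₁ - gradX F x₂ y₂‖ ≤ L * (‖x₁ - x₂‖ + ‖y₁ - y₂‖)
  lip_y : ∀ x₁ x₂ y₁ y₂,
    ‖gradY F x₁ y₁ - gradY F x₂ y₂‖ ≤ L * (‖x₁ - x₂‖ + ‖y₁ - y₂‖)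

/-- `F` has a stationary point; every `F(·, y)` attains its minimum and every `F(x, ·)` attains
its maximum. -/
structure HasStationaryPoint (F : Vec n → Vec m → ℝ) : Prop where
  stationary : ∃ x y, gradX F x y = 0 ∧ gradY F x y = 0
  argmin_nonempty : ∀ y, ∃ x₀, ∀ x, F x₀ y ≤ F x y
  argmax_nonempty : ∀ x, ∃ y₀, ∀ y, F x y ≤ F x y₀

/-- The two-sided Polyak–Łojasiewicz condition with constants `μ₁, μ₂ > 0`. -/
structure TwoSidedPL (F : Vec n → Vec m → ℝ) (μ₁ μ₂ : ℝ) : Prop where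
  pos₁ : 0 < μ₁
  pos₂ : 0 < μ₂
  pl_x : ∀ x y, μ₁ * (F x y - ⨅ x', F x' y) ≤ 1 / 2 * ‖gradX F x y‖ ^ 2
  pl_y : ∀ x y, μ₂ * ((⨆ y', F x y') - F x y) ≤ 1 / 2 * ‖gradY F x y‖ ^ 2

/-- Deterministic alternating gradient descent–ascent with constant step sizes. -/
structure IsAltGDA (F : Vec n → Vec m → ℝ) (α β : ℝ) (x : ℕ → Vec n) (y : ℕ → Vec m) :
    Prop where
  step_x : ∀ k, x (k + 1) = x k - α • gradX F (x k) (y k)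
  step_y : ∀ k, y (k + 1) = y k + β • gradY F (x (k + 1)) (y k)

/-- `h(x) = max_y F(x, y)`. -/
def primal (F : Vec n → Vec m → ℝ) (x : Vec n) : ℝ := ⨆ y, F x y

/-- `h* = min_x h(x)`. -/
def primalMin (F : Vec n → Vec m → ℝ) : ℝ := ⨅ x, primal F x

/-- The potential `(h(x) - h*) + λ (h(x) - F(x, y))`, where `lam` stands for `λ`. -/
def potential (F : Vec n → Vec m → ℝ) (lam : ℝ) (x : Vec n) (y : Vec m) : ℝ :=
  (primal F x - primalMin F) + lam * (primal F x - F x y)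

end Minimax

end

/-! The function `h = primal F` need not be differentiated: at `x`, the vector `∇ₓF(x, z)` for a
maximizer `z` of `F(x, ·)` serves as its gradient, with a quadratic upper bound (`primal_add_le`)
and a PL inequality (`primal_PL`). The `x`-update is then inexact gradient descent on `h`. Its error
`∇ₓF(x, y) - ∇ₓF(x, z)` is at most `L‖y - z‖`, and quadratic growth
(`exists_maximizer_dist_sq_le_of_PL`) supplies a `z` with `‖y - z‖²` bounded by a multiple of `b`.
The ascent step in `y` shrinks the gap by `1 - μ₂/L`, so the potential of weight `1/10` contracts
(`potential_step_le`).

The squared gradients are bounded by `40L²/μ₂` times a potential of another weight, which can exceed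
`1/10`. One step carries weight `1/10` to that weight at the same rate, so the last of the `k ≥ 1`
steps is spent on the change of weight. Only the second entry of the maximum `M` is needed. -/

/-! ### Lipschitz gradients and quadratic growth under PL -/

section Smooth

variable {E : Type*} [NormedAddCommGroup E] [InnerProductSpace ℝ E] [CompleteSpace E]

open scoped InnerProductSpace

/-- The quadratic upper bound for a function with Lipschitz gradient. -/
lemma le_add_inner_add_sq_of_lipschitz_gradient {f : E → ℝ} {L : ℝ}
    (hf : ∀ x, DifferentiableAt ℝ f x)
    (hL : ∀ x y, ‖gradient f x - gradient f y‖ ≤ L * ‖x - y‖) (x d : E) :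
    f (x + d) ≤ f x + ⟪gradient f x, d⟫_ℝ + L / 2 * ‖d‖ ^ 2 := by
  set φ : ℝ → ℝ := fun t => f (x + t • d) - t * ⟪gradient f x, d⟫_ℝ - t ^ 2 * (L / 2 * ‖d‖ ^ 2)
    with hφ
  have hder : ∀ t : ℝ, HasDerivAt φ (⟪gradient f (x + t • d), d⟫_ℝ - ⟪gradient f x, d⟫_ℝ
      - 2 * t * (L / 2 * ‖d‖ ^ 2)) t := by
    intro t
    have hline : HasDerivAt (fun s : ℝ => x + s • d) d t := by
      simpa using ((hasDerivAt_id t).smul_const d).const_add x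
    have hg := (hf (x + t • d)).hasGradientAt.hasFDerivAt.comp_hasDerivAt t hline
    have hlin := (hasDerivAt_id t).mul_const ⟪gradient f x, d⟫_ℝ
    have hsq := (hasDerivAt_pow 2 t).mul_const (L / 2 * ‖d‖ ^ 2)
    exact ((hg.sub hlin).sub hsq).congr_deriv (by simp)
  have hanti : AntitoneOn φ (Set.Icc 0 1) := by
    refine antitoneOn_of_deriv_nonpos (convex_Icc 0 1)
      (fun t _ => (hder t).continuousAt.continuousWithinAt)
      (fun t _ => (hder t).differentiableAt.differentiableWithinAt) fun t ht => ?_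
    rw [interior_Icc] at ht
    rw [(hder t).deriv, ← inner_sub_left]
    have h1 := real_inner_le_norm (gradient f (x + t • d) - gradient f x) d
    have h2 := hL (x + t • d) x
    rw [add_sub_cancel_left, norm_smul, Real.norm_of_nonneg ht.1.le] at h2
    nlinarith [mul_le_mul_of_nonneg_right h2 (norm_nonneg d)]
  have h := hanti (Set.left_mem_Icc.2 zero_le_one) (Set.right_mem_Icc.2 zero_le_one) zero_le_one
  simp only [hφ, one_smul, zero_smul, add_zero] at h
  linarith

lemma gradient_fun_neg (f : E → ℝ) (x : E) : gradient (fun z => -f z) x = -gradient f x := by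
  simp [gradient, fderiv_fun_neg]

/-- The quadratic lower bound for a function with Lipschitz gradient. -/
lemma add_inner_sub_sq_le_of_lipschitz_gradient {f : E → ℝ} {L : ℝ}
    (hf : ∀ x, DifferentiableAt ℝ f x)
    (hL : ∀ x y, ‖gradient f x - gradient f y‖ ≤ L * ‖x - y‖) (x d : E) :
    f x + ⟪gradient f x, d⟫_ℝ - L / 2 * ‖d‖ ^ 2 ≤ f (x + d) := by
  have h := le_add_inner_add_sq_of_lipschitz_gradient (f := fun z => -f z) (L := L)
    (fun z => (hf z).neg) (fun a b => by
      rw [gradient_fun_neg, gradient_fun_neg, ← neg_sub', norm_neg]; exact hL a b) x d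
  rw [gradient_fun_neg, inner_neg_left] at h
  linarith

/-- Increase of the objective along a gradient ascent step of length `η`. -/
lemma gradient_ascent_step {f : E → ℝ} {L : ℝ}
    (hf : ∀ x, DifferentiableAt ℝ f x)
    (hL : ∀ x y, ‖gradient f x - gradient f y‖ ≤ L * ‖x - y‖) (x : E) (η : ℝ) :
    f x + η * (1 - L * η / 2) * ‖gradient f x‖ ^ 2 ≤ f (x + η • gradient f x) := by
  have h := add_inner_sub_sq_le_of_lipschitz_gradient hf hL x (η • gradient f x)
  rw [real_inner_smul_right, real_inner_self_eq_norm_sq, norm_smul, mul_pow, Real.norm_eq_abs,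
    sq_abs] at h
  linarith

lemma gradient_ascent_step_inv {f : E → ℝ} {L : ℝ} (hpos : 0 < L)
    (hf : ∀ x, DifferentiableAt ℝ f x)
    (hL : ∀ x y, ‖gradient f x - gradient f y‖ ≤ L * ‖x - y‖) (x : E) :
    f x + ‖gradient f x‖ ^ 2 / (2 * L) ≤ f (x + (1 / L) • gradient f x) := by
  refine le_trans (le_of_eq ?_) (gradient_ascent_step hf hL x (1 / L))
  field_simp
  ring

lemma norm_gradient_sq_le_of_le {f : E → ℝ} {L B : ℝ} (hpos : 0 < L)
    (hf : ∀ x, DifferentiableAt ℝ f x)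
    (hL : ∀ x y, ‖gradient f x - gradient f y‖ ≤ L * ‖x - y‖) (hB : ∀ z, f z ≤ B) (x : E) :
    ‖gradient f x‖ ^ 2 ≤ 2 * L * (B - f x) := by
  have h1 := (gradient_ascent_step_inv hpos hf hL x).trans (hB _)
  have h2 : ‖gradient f x‖ ^ 2 / (2 * L) ≤ B - f x := by linarith
  rw [div_le_iff₀ (by positivity)] at h2
  linarith

/-- Under the Polyak–Łojasiewicz condition, the squared distance to the set of maximizers is
controlled by the optimality gap. -/
lemma exists_maximizer_dist_sq_le_of_PL [ProperSpace E] {f : E → ℝ} {L μ B : ℝ} (hpos : 0 < L)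
    (hμ : 0 < μ) (hf : ∀ x, DifferentiableAt ℝ f x)
    (hL : ∀ x y, ‖gradient f x - gradient f y‖ ≤ L * ‖x - y‖) (hB : ∀ z, f z ≤ B)
    (hPL : ∀ z, μ * (B - f z) ≤ 1 / 2 * ‖gradient f z‖ ^ 2) (y : E) :
    ∃ z, f z = B ∧ μ * ‖y - z‖ ^ 2 ≤ 5 / 2 * (B - f y) := by
  set c : ℝ := √(2 / 5 * μ) with hc
  have hc0 : 0 < c := Real.sqrt_pos.2 (by positivity)
  have hc2 : c ^ 2 = 2 / 5 * μ := Real.sq_sqrt (by positivity)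
  have hfc : Continuous f := continuous_iff_continuousAt.2 fun z => (hf z).continuousAt
  -- A variational argument replaces gradient flow: a minimizer of this coercive function must
  -- maximize `f`, since otherwise a short gradient step would lower it.
  obtain ⟨z, hz⟩ : ∃ z, ∀ w, √(B - f z) + c * ‖y - z‖ ≤ √(B - f w) + c * ‖y - w‖ := by
    refine Continuous.exists_forall_le (f := fun z => √(B - f z) + c * ‖y - z‖)
      (by fun_prop) ?_
    refine Filter.tendsto_atTop_mono (f := fun z => c * (‖z‖ - ‖y‖)) (fun z => ?_) ?_
    · have h1 := norm_sub_norm_le z y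
      rw [norm_sub_rev] at h1
      have := mul_le_mul_of_nonneg_left h1 hc0.le
      have := Real.sqrt_nonneg (B - f z)
      linarith
    · exact (Filter.tendsto_atTop_add_const_right _ _ (tendsto_norm_cocompact_atTop)).const_mul_atTop
        hc0
  have hzB : f z = B := by
    by_contra hne
    have hgap : 0 < B - f z := sub_pos.2 (lt_of_le_of_ne (hB z) hne)
    have hstep := gradient_ascent_step hf hL z (1 / (5 * L))
    set w := z + (1 / (5 * L)) • gradient f z with hw
    set N := ‖gradient f z‖ with hN
    set s := √(B - f z) with hs
    set r := √(B - f w) with hr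
    have hs0 : 0 < s := Real.sqrt_pos.2 hgap
    have hr0 : 0 ≤ r := Real.sqrt_nonneg _
    have hs2 : s ^ 2 = B - f z := Real.sq_sqrt hgap.le
    have hr2 : r ^ 2 = B - f w := Real.sq_sqrt (sub_nonneg.2 (hB w))
    have hN0 : 0 ≤ N := norm_nonneg _
    have hN2 : μ * s ^ 2 ≤ 1 / 2 * N ^ 2 := by rw [hs2]; exact hPL z
    have hNs : 0 < N := by
      rcases hN0.eq_or_lt with h | h
      · rw [← h] at hN2
        have : 0 < μ * s ^ 2 := by positivity
        linarith
      · exact h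
    set δ := 1 / (5 * L) with hδ
    have hδ0 : 0 < δ := by positivity
    have hLδ : L * δ = 1 / 5 := by rw [hδ]; field_simp
    have hdec : δ * (9 / 10) * N ^ 2 ≤ s ^ 2 - r ^ 2 := by
      rw [hs2, hr2]
      have : 1 - L * δ / 2 = 9 / 10 := by rw [hLδ]; norm_num
      rw [this] at hstep
      linarith
    have hmove : ‖y - w‖ ≤ ‖y - z‖ + δ * N := by
      have : y - w = (y - z) - δ • gradient f z := by rw [hw]; abel
      rw [this]
      refine (norm_sub_le _ _).trans (le_of_eq ?_)
      rw [norm_smul, Real.norm_of_nonneg hδ0.le]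
    have hmin : s - r ≤ c * (δ * N) := by
      have h1 := hz w
      have h2 := mul_le_mul_of_nonneg_left hmove hc0.le
      linarith
    -- PL gives `c²s² ≤ N²/5`, and `1/5 < (9/20)²`. The step `1/(5L)` leaves just this slack, at the
    -- price of `5/2` instead of the sharp constant `2`.
    have hcs : c * s < 9 / 20 * N := by
      refine lt_of_pow_lt_pow_left₀ 2 (by positivity) ?_
      rw [mul_pow, mul_pow, hc2]
      have : 0 < N ^ 2 := by positivity
      nlinarith
    have hrs : r ≤ s := by
      refine le_of_sq_le_sq ?_ hs0.le
      have : 0 ≤ δ * (9 / 10) * N ^ 2 := by positivity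
      linarith
    have h1 : s ^ 2 - r ^ 2 ≤ (c * (δ * N)) * (2 * s) := by
      have : s ^ 2 - r ^ 2 = (s - r) * (s + r) := by ring
      rw [this]
      exact mul_le_mul hmin (by linarith) (by linarith) (by positivity)
    have h2 : (δ * N) * (c * s) < (δ * N) * (9 / 20 * N) :=
      mul_lt_mul_of_pos_left hcs (by positivity)
    nlinarith
  refine ⟨z, hzB, ?_⟩
  have h := hz y
  rw [hzB, sub_self, Real.sqrt_zero, zero_add, sub_self, norm_zero, mul_zero, add_zero] at h
  have h2 := pow_le_pow_left₀ (by positivity) h 2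
  rw [Real.sq_sqrt (sub_nonneg.2 (hB y)), mul_pow, hc2] at h2
  linarith

end Smooth

/-! ### The primal function -/

namespace Minimax

open scoped InnerProductSpace

variable {n m : ℕ} {F : Vec n → Vec m → ℝ} {L μ₁ μ₂ : ℝ}

lemma LSmooth.lip_x_left (hL : LSmooth F L) (y : Vec m) (x₁ x₂ : Vec n) :
    ‖gradX F x₁ y - gradX F x₂ y‖ ≤ L * ‖x₁ - x₂‖ := by
  simpa using hL.lip_x x₁ x₂ y y

lemma LSmooth.lip_y_right (hL : LSmooth F L) (x : Vec n) (y₁ y₂ : Vec m) :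
    ‖gradY F x y₁ - gradY F x y₂‖ ≤ L * ‖y₁ - y₂‖ := by
  simpa using hL.lip_y x x y₁ y₂

lemma HasStationaryPoint.le_primal (hS : HasStationaryPoint F) (x : Vec n) (y : Vec m) :
    F x y ≤ primal F x := by
  obtain ⟨y₀, hy₀⟩ := hS.argmax_nonempty x
  exact le_ciSup (f := fun y => F x y) ⟨F x y₀, by rintro _ ⟨y, rfl⟩; exact hy₀ y⟩ y

lemma HasStationaryPoint.iInf_le (hS : HasStationaryPoint F) (x : Vec n) (y : Vec m) :
    ⨅ x', F x' y ≤ F x y := by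
  obtain ⟨x₀, hx₀⟩ := hS.argmin_nonempty y
  exact ciInf_le (f := fun x => F x y) ⟨F x₀ y, by rintro _ ⟨x, rfl⟩; exact hx₀ x⟩ x

lemma HasStationaryPoint.iInf_le_primalMin (hS : HasStationaryPoint F) (y : Vec m) :
    ⨅ x', F x' y ≤ primalMin F :=
  le_ciInf fun x' => (hS.iInf_le x' y).trans (hS.le_primal x' y)

lemma HasStationaryPoint.primalMin_le (hS : HasStationaryPoint F) (x : Vec n) :
    primalMin F ≤ primal F x := by
  obtain ⟨x₀, hx₀⟩ := hS.argmin_nonempty 0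
  exact ciInf_le (f := primal F)
    ⟨F x₀ 0, by rintro _ ⟨x, rfl⟩; exact (hx₀ x).trans (hS.le_primal x 0)⟩ x

lemma gradY_eq_zero_of_eq_primal (hS : HasStationaryPoint F) {x : Vec n} {y : Vec m}
    (hy : F x y = primal F x) : gradY F x y = 0 := by
  have hmax : IsLocalMax (fun y' => F x y') y :=
    Filter.Eventually.of_forall fun z => (hS.le_primal x z).trans_eq hy.symm
  simp [gradY, gradient, hmax.fderiv_eq_zero]

lemma gradY_sq_le (hL : LSmooth F L) (hS : HasStationaryPoint F) (x : Vec n) (y : Vec m) :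
    ‖gradY F x y‖ ^ 2 ≤ 2 * L * (primal F x - F x y) :=
  norm_gradient_sq_le_of_le hL.pos (hL.diff_y x) (hL.lip_y_right x) (hS.le_primal x) y

/-- A maximizer of `F(x, ·)` whose squared distance to `y` is controlled by the gap at `y`. -/
lemma exists_maximizer_dist_sq_le (hL : LSmooth F L) (hS : HasStationaryPoint F)
    (hPL : TwoSidedPL F μ₁ μ₂) (x : Vec n) (y : Vec m) :
    ∃ z, F x z = primal F x ∧ μ₂ * ‖y - z‖ ^ 2 ≤ 5 / 2 * (primal F x - F x y) :=
  exists_maximizer_dist_sq_le_of_PL hL.pos hPL.pos₂ (hL.diff_y x) (hL.lip_y_right x)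
    (hS.le_primal x) (hPL.pl_y x) y

/-- The quadratic upper bound for the primal function at `x`, with slope `∇ₓ F(x, y)` for any
maximizer `y` of `F(x, ·)`. -/
lemma primal_add_le (hL : LSmooth F L) (hS : HasStationaryPoint F) (hPL : TwoSidedPL F μ₁ μ₂)
    {x : Vec n} {y : Vec m} (hy : F x y = primal F x) (d : Vec n) :
    primal F (x + d) ≤
      primal F x + ⟪gradX F x y, d⟫_ℝ + (L + L ^ 2 / μ₂) / 2 * ‖d‖ ^ 2 := by
  have hμ := hPL.pos₂
  have h1 : F (x + d) y ≤ F x y + ⟪gradX F x y, d⟫_ℝ + L / 2 * ‖d‖ ^ 2 :=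
    le_add_inner_add_sq_of_lipschitz_gradient (fun z => hL.diff_x z y) (hL.lip_x_left y) x d
  have h2 : μ₂ * (primal F (x + d) - F (x + d) y) ≤ 1 / 2 * ‖gradY F (x + d) y‖ ^ 2 :=
    hPL.pl_y (x + d) y
  -- `∇_y F` vanishes at `(x, y)`, so moving `x` by `d` makes it at most `L‖d‖`; PL turns this into
  -- a bound on the suboptimality of the old `y`.
  have h3 : ‖gradY F (x + d) y‖ ≤ L * ‖d‖ := by
    simpa [gradY_eq_zero_of_eq_primal hS hy] using hL.lip_y (x + d) x y y
  have h4 : ‖gradY F (x + d) y‖ ^ 2 ≤ L ^ 2 * ‖d‖ ^ 2 := by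
    rw [← mul_pow]; exact pow_le_pow_left₀ (norm_nonneg _) h3 2
  have h5 : primal F (x + d) - F (x + d) y ≤ L ^ 2 / μ₂ / 2 * ‖d‖ ^ 2 := by
    have : L ^ 2 / μ₂ / 2 * ‖d‖ ^ 2 = (1 / 2 * (L ^ 2 * ‖d‖ ^ 2)) / μ₂ := by ring
    rw [this, le_div_iff₀ hμ]
    linarith
  linarith

/-- The primal function inherits the Polyak–Łojasiewicz condition. -/
lemma primal_PL (hS : HasStationaryPoint F) (hPL : TwoSidedPL F μ₁ μ₂)
    {x : Vec n} {y : Vec m} (hy : F x y = primal F x) :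
    μ₁ * (primal F x - primalMin F) ≤ 1 / 2 * ‖gradX F x y‖ ^ 2 := by
  refine le_trans (mul_le_mul_of_nonneg_left ?_ hPL.pos₁.le) (hPL.pl_x x y)
  have := hS.iInf_le_primalMin y
  linarith

/-- A step of length `1/K` along `-∇ₓF(x, y)` in the quadratic bound cannot take `h` below its
infimum. -/
lemma primal_gradient_sq_le (hL : LSmooth F L) (hS : HasStationaryPoint F)
    (hPL : TwoSidedPL F μ₁ μ₂) {x : Vec n} {y : Vec m} (hy : F x y = primal F x) :
    ‖gradX F x y‖ ^ 2 ≤ 2 * (L + L ^ 2 / μ₂) * (primal F x - primalMin F) := by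
  have hμ := hPL.pos₂
  have hL0 := hL.pos
  set K := L + L ^ 2 / μ₂ with hK
  have hK0 : 0 < K := by positivity
  have h := primal_add_le hL hS hPL hy (-(1 / K) • gradX F x y)
  rw [← hK, real_inner_smul_right, real_inner_self_eq_norm_sq, norm_smul, mul_pow,
    Real.norm_eq_abs, sq_abs] at h
  have h2 := (hS.primalMin_le _).trans h
  have h3 : -(1 / K) * ‖gradX F x y‖ ^ 2 + K / 2 * ((-(1 / K)) ^ 2 * ‖gradX F x y‖ ^ 2)
      = -(‖gradX F x y‖ ^ 2 / (2 * K)) := by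
    field_simp
    ring
  have h4 : ‖gradX F x y‖ ^ 2 / (2 * K) ≤ primal F x - primalMin F := by linarith
  rw [div_le_iff₀ (by positivity)] at h4
  linarith

/-- At a point with positive gap, PL and smoothness bound the squared gradient by `2μ₂` and `2L`
times that gap, from below and above. Such a point exists unless `F` is constant in `y`. -/
lemma mu₂_le (hL : LSmooth F L) (hS : HasStationaryPoint F) (hPL : TwoSidedPL F μ₁ μ₂)
    (hdeg : (∀ x y y', F x y = F x y') → μ₂ ≤ L) : μ₂ ≤ L := by
  by_cases h : ∀ x y y', F x y = F x y'
  · exact hdeg h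
  · push Not at h
    obtain ⟨x, y, y', hne⟩ := h
    have key : ∀ z, F x z < primal F x → μ₂ ≤ L := fun z hz => by
      have h1 := gradY_sq_le hL hS x z
      have h2 : μ₂ * (primal F x - F x z) ≤ 1 / 2 * ‖gradY F x z‖ ^ 2 := hPL.pl_y x z
      exact le_of_mul_le_mul_right (by linarith) (sub_pos.2 hz)
    rcases lt_or_gt_of_ne hne with h | h
    · exact key y (h.trans_le (hS.le_primal x y'))
    · exact key y' (h.trans_le (hS.le_primal x y))

lemma mu₁_le (hL : LSmooth F L) (hS : HasStationaryPoint F) (hPL : TwoSidedPL F μ₁ μ₂)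
    (hdeg : (∀ x x' y, F x y = F x' y) → μ₁ ≤ L) : μ₁ ≤ L := by
  by_cases h : ∀ x x' y, F x y = F x' y
  · exact hdeg h
  · push Not at h
    obtain ⟨x, x', y, hne⟩ := h
    have key : ∀ z, ⨅ w, F w y < F z y → μ₁ ≤ L := fun z hz => by
      have h1 : ‖gradX F z y‖ ^ 2 ≤ 2 * L * (-(⨅ w, F w y) - -F z y) := by
        have := norm_gradient_sq_le_of_le (f := fun w => -F w y) (B := -⨅ w, F w y) hL.pos
          (fun w => (hL.diff_x w y).neg) (fun a b => by
            rw [gradient_fun_neg, gradient_fun_neg, ← neg_sub', norm_neg]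
            exact hL.lip_x_left y a b) (fun w => neg_le_neg (hS.iInf_le w y)) z
        rwa [gradient_fun_neg, norm_neg] at this
      have h2 := hPL.pl_x z y
      exact le_of_mul_le_mul_right (by linarith) (sub_pos.2 hz)
    rcases lt_or_gt_of_ne hne with h | h
    · exact key x' ((hS.iInf_le x y).trans_lt h)
    · exact key x ((hS.iInf_le x' y).trans_lt h)

/-! ### Gradient bound and contraction of the potential -/

/-- Both squared partial gradients are controlled by the primal gap and the dual gap. -/
lemma gradient_sq_add_le (hL : LSmooth F L) (hS : HasStationaryPoint F)
    (hPL : TwoSidedPL F μ₁ μ₂) (hμL : μ₂ ≤ L) (x : Vec n) (y : Vec m) :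
    ‖gradX F x y‖ ^ 2 + ‖gradY F x y‖ ^ 2 ≤
      40 * L ^ 2 / μ₂ * potential F (25 / 360 + μ₂ / L / 20) x y := by
  have hμ := hPL.pos₂
  have hL0 := hL.pos
  obtain ⟨z, hz, hdist⟩ := exists_maximizer_dist_sq_le hL hS hPL x y
  have hg := primal_gradient_sq_le hL hS hPL hz
  have hY := gradY_sq_le hL hS x y
  have he : ‖gradX F x y - gradX F x z‖ ≤ L * ‖y - z‖ := by simpa using hL.lip_x x x y z
  have he2 : ‖gradX F x y - gradX F x z‖ ^ 2 ≤ L ^ 2 / μ₂ * (5 / 2 * (primal F x - F x y)) := by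
    calc _ ≤ (L * ‖y - z‖) ^ 2 := pow_le_pow_left₀ (norm_nonneg _) he 2
      _ = L ^ 2 / μ₂ * (μ₂ * ‖y - z‖ ^ 2) := by field_simp
      _ ≤ _ := mul_le_mul_of_nonneg_left hdist (by positivity)
  have htri : ‖gradX F x y‖ ≤ ‖gradX F x z‖ + ‖gradX F x y - gradX F x z‖ := by
    simpa using norm_add_le (gradX F x z) (gradX F x y - gradX F x z)
  -- Young's inequality with unequal weights: the primal term can afford `10`, since `10 · 2(L +
  -- L²/μ₂) ≤ 40L²/μ₂`, which keeps the factor on the error near `1`.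
  have hX : ‖gradX F x y‖ ^ 2 ≤
      10 * ‖gradX F x z‖ ^ 2 + 10 / 9 * ‖gradX F x y - gradX F x z‖ ^ 2 := by
    have h1 := pow_le_pow_left₀ (norm_nonneg _) htri 2
    nlinarith [sq_nonneg (9 * ‖gradX F x z‖ - ‖gradX F x y - gradX F x z‖)]
  have ha : 0 ≤ primal F x - primalMin F := sub_nonneg.2 (hS.primalMin_le x)
  have hLμ : L ≤ L ^ 2 / μ₂ := by
    rw [le_div_iff₀ hμ]; nlinarith
  have hrhs : 40 * L ^ 2 / μ₂ * potential F (25 / 360 + μ₂ / L / 20) x y =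
      40 * (L ^ 2 / μ₂) * (primal F x - primalMin F) +
        (25 / 9 * (L ^ 2 / μ₂) + 2 * L) * (primal F x - F x y) := by
    rw [potential]
    field_simp
    ring
  rw [hrhs]
  have := mul_le_mul_of_nonneg_right hLμ ha
  nlinarith

/-- One step of alternating gradient descent–ascent, for a potential with a general weight. -/
lemma potential_step_le (hL : LSmooth F L) (hS : HasStationaryPoint F)
    (hPL : TwoSidedPL F μ₁ μ₂) (hμL : μ₂ ≤ L) {lam : ℝ} (hlam : 0 ≤ lam)
    (hlam' : lam * (1 - μ₂ / L) ≤ 1 / 10) {x x' : Vec n} {y y' : Vec m}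
    (hx : x' = x - (μ₂ ^ 2 / (18 * L ^ 3)) • gradX F x y)
    (hy : y' = y + (1 / L) • gradY F x' y) :
    potential F lam x' y' ≤
      (1 - μ₂ ^ 2 / (18 * L ^ 3) * μ₁) * (primal F x - primalMin F) +
        (lam * (1 - μ₂ / L) + 11 / 144 * (μ₂ / L)) * (primal F x - F x y) := by
  have hμ := hPL.pos₂
  have hμ₁ := hPL.pos₁
  have hL0 := hL.pos
  obtain ⟨z, hz, hdist⟩ := exists_maximizer_dist_sq_le hL hS hPL x y
  have hg := primal_PL hS hPL hz
  have he : ‖gradX F x y - gradX F x z‖ ≤ L * ‖y - z‖ := by simpa using hL.lip_x x x y z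
  have he2 : ‖gradX F x y - gradX F x z‖ ^ 2 ≤ L ^ 2 / μ₂ * (5 / 2 * (primal F x - F x y)) := by
    calc _ ≤ (L * ‖y - z‖) ^ 2 := pow_le_pow_left₀ (norm_nonneg _) he 2
      _ = L ^ 2 / μ₂ * (μ₂ * ‖y - z‖ ^ 2) := by field_simp
      _ ≤ _ := mul_le_mul_of_nonneg_left hdist (by positivity)
  set α := μ₂ ^ 2 / (18 * L ^ 3) with hα
  set u := μ₂ / L with hu
  have hα0 : 0 < α := by positivity
  have hu0 : 0 < u := by positivity
  have hu1 : u ≤ 1 := (div_le_one hL0).2 hμL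
  have hxd : x' = x + -(α • gradX F x y) := by rw [hx, sub_eq_add_neg]
  have hprimal := primal_add_le hL hS hPL hz (-(α • gradX F x y))
  have hFx : F x y + ⟪gradX F x y, -(α • gradX F x y)⟫_ℝ - L / 2 * ‖-(α • gradX F x y)‖ ^ 2
      ≤ F (x + -(α • gradX F x y)) y :=
    add_inner_sub_sq_le_of_lipschitz_gradient (fun w => hL.diff_x w y) (hL.lip_x_left y) x _
  rw [← hxd, inner_neg_right, real_inner_smul_right, norm_neg, norm_smul, mul_pow,
    Real.norm_eq_abs, sq_abs] at hprimal hFx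
  rw [real_inner_self_eq_norm_sq] at hFx
  have hasc : F x' y + ‖gradY F x' y‖ ^ 2 / (2 * L) ≤ F x' y' := by
    rw [hy]
    exact gradient_ascent_step_inv hL0 (hL.diff_y x') (hL.lip_y_right x') y
  have hPLy : μ₂ * (primal F x' - F x' y) ≤ 1 / 2 * ‖gradY F x' y‖ ^ 2 := hPL.pl_y x' y
  have hinner := norm_sub_sq_real (gradX F x y) (gradX F x z)
  rw [real_inner_comm] at hinner
  have hb' : primal F x' - F x' y' ≤ (1 - u) * (primal F x' - F x' y) := by
    have h1 : u * (primal F x' - F x' y) ≤ ‖gradY F x' y‖ ^ 2 / (2 * L) := by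
      rw [hu, le_div_iff₀ (by positivity)]
      have : μ₂ / L * (primal F x' - F x' y) * (2 * L) = 2 * (μ₂ * (primal F x' - F x' y)) := by
        field_simp
      linarith
    linarith
  have hαK : α * (L + L ^ 2 / μ₂) ≤ 1 / 9 := by
    have : α * (L + L ^ 2 / μ₂) = (u ^ 2 + u) / 18 := by
      rw [hα, hu]; field_simp
    rw [this]
    nlinarith
  have hαL : α * L ≤ 1 / 18 := by
    have : α * L = u ^ 2 / 18 := by
      rw [hα, hu]; field_simp
    rw [this]
    nlinarith
  have hαe : α * ‖gradX F x y - gradX F x z‖ ^ 2 ≤ 5 / 36 * u * (primal F x - F x y) := by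
    refine (mul_le_mul_of_nonneg_left he2 hα0.le).trans (le_of_eq ?_)
    rw [hα, hu]
    field_simp
    ring
  have hb0 : 0 ≤ primal F x - F x y := sub_nonneg.2 (hS.le_primal x y)
  have ha0 : 0 ≤ primal F x - primalMin F := sub_nonneg.2 (hS.primalMin_le x)
  rw [potential]
  generalize gradX F x y = G at *
  generalize gradX F x z = g at *
  set θ := lam * (1 - u) with hθ
  have hθ0 : 0 ≤ θ := mul_nonneg hlam (by linarith)
  have hGG : 0 ≤ α * ‖G‖ ^ 2 := by positivity
  -- Polarizing `⟪g, G⟫` gives `-1/2` on `α‖G‖²`; the quadratic term adds `1/18`, leaving `-4/9`.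
  -- This negative term is kept to absorb the loss in `hc`.
  have hdec : primal F x' - primal F x ≤ -(α * μ₁) * (primal F x - primalMin F)
      - 4 / 9 * (α * ‖G‖ ^ 2) + 5 / 72 * u * (primal F x - F x y) := by
    have h1 : (L + L ^ 2 / μ₂) / 2 * (α ^ 2 * ‖G‖ ^ 2) ≤ 1 / 18 * (α * ‖G‖ ^ 2) := by
      have := mul_le_mul_of_nonneg_right hαK hGG
      linarith
    have h2 := mul_le_mul_of_nonneg_left hg hα0.le
    have h3 : α * ⟪g, G⟫_ℝ = 1 / 2 * (α * ‖G‖ ^ 2 + α * ‖g‖ ^ 2 - α * ‖G - g‖ ^ 2) := by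
      rw [hinner]; ring
    linarith
  -- Descent in `x` also lowers `F(·, y)`, by at most `(1 + αL/2)α‖G‖²`.
  have hc : primal F x' - F x' y ≤ (primal F x - F x y) + (primal F x' - primal F x)
      + 37 / 36 * (α * ‖G‖ ^ 2) := by
    have h1 := mul_le_mul_of_nonneg_right hαL hGG
    linarith
  have hlamb : lam * (primal F x' - F x' y') ≤ θ * (primal F x' - F x' y) := by
    rw [hθ, mul_assoc]
    exact mul_le_mul_of_nonneg_left hb' hlam
  have hθc := mul_le_mul_of_nonneg_left hc hθ0
  have hθd := mul_le_mul_of_nonneg_left hdec (by linarith : 0 ≤ 1 + θ)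
  have h1 : 0 ≤ θ * (α * μ₁ * (primal F x - primalMin F)) := by positivity
  have h2 : θ * (α * ‖G‖ ^ 2) ≤ 1 / 10 * (α * ‖G‖ ^ 2) := mul_le_mul_of_nonneg_right hlam' hGG
  have h3 : θ * (u * (primal F x - F x y)) ≤ 1 / 10 * (u * (primal F x - F x y)) :=
    mul_le_mul_of_nonneg_right hlam' (by positivity)
  -- The coefficient of `α‖G‖²` is `-4/9 + 7θ/12 < 0` as `θ ≤ 1/10`; that of the gap is at most `θ +
  -- (11/10)(5/72)u = θ + 11u/144`.
  linarith

/-- One step of alternating gradient descent–ascent maps the potential of weight `1 / 10` into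
any potential whose weight satisfies the stated numerical condition. -/
lemma potential_step_le_mul_potential (hL : LSmooth F L) (hS : HasStationaryPoint F)
    (hPL : TwoSidedPL F μ₁ μ₂) (hμL : μ₂ ≤ L) {lam : ℝ} (hlam : 0 ≤ lam) (hμL₁ : μ₁ ≤ L)
    (hlam' : lam * (1 - μ₂ / L) ≤ 1 / 10)
    (hrate : lam * (1 - μ₂ / L) + 11 / 144 * (μ₂ / L) ≤ 1 / 10 * (1 - μ₂ / L / 36))
    {x x' : Vec n} {y y' : Vec m}
    (hx : x' = x - (μ₂ ^ 2 / (18 * L ^ 3)) • gradX F x y)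
    (hy : y' = y + (1 / L) • gradY F x' y) :
    potential F lam x' y' ≤
      (1 - μ₁ * μ₂ ^ 2 / (36 * L ^ 3)) * potential F (1 / 10) x y := by
  have hμ := hPL.pos₂
  have hμ₁ := hPL.pos₁
  have hL0 := hL.pos
  refine (potential_step_le hL hS hPL hμL hlam hlam' hx hy).trans ?_
  have hb0 : 0 ≤ primal F x - F x y := sub_nonneg.2 (hS.le_primal x y)
  have ha0 : 0 ≤ primal F x - primalMin F := sub_nonneg.2 (hS.primalMin_le x)
  have h1 : μ₂ ^ 2 / (18 * L ^ 3) * μ₁ = 2 * (μ₁ * μ₂ ^ 2 / (36 * L ^ 3)) := by ring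
  have h2 : 0 ≤ μ₁ * μ₂ ^ 2 / (36 * L ^ 3) := by positivity
  have h3 : μ₁ * μ₂ ^ 2 / (36 * L ^ 3) ≤ μ₂ / L / 36 := by
    rw [div_div, div_le_div_iff₀ (by positivity) (by positivity)]
    have : μ₁ * μ₂ ≤ L * L := mul_le_mul hμL₁ hμL hμ.le hL0.le
    have := mul_le_mul_of_nonneg_right this (by positivity : 0 ≤ μ₂ * L * 36)
    linarith
  rw [potential, h1]
  have h4 := mul_nonneg h2 ha0
  have h5 := mul_le_mul_of_nonneg_right
    (hrate.trans (by linarith : _ ≤ 1 / 10 * (1 - μ₁ * μ₂ ^ 2 / (36 * L ^ 3)))) hb0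
  linarith

lemma potential_nonneg (hS : HasStationaryPoint F) {lam : ℝ} (hlam : 0 ≤ lam) (x : Vec n)
    (y : Vec m) : 0 ≤ potential F lam x y :=
  add_nonneg (sub_nonneg.2 (hS.primalMin_le x))
    (mul_nonneg hlam (sub_nonneg.2 (hS.le_primal x y)))

end Minimax

/-! ### The convergence rate -/

theorem theorem2 {n m : ℕ} (F : Minimax.Vec n → Minimax.Vec m → ℝ) (L μ₁ μ₂ : ℝ)
    (hL : Minimax.LSmooth F L)
    (hS : Minimax.HasStationaryPoint F)
    (hPL : Minimax.TwoSidedPL F μ₁ μ₂)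
    -- If `F` does not depend on one of its variables, the PL condition in that variable holds
    -- with every constant; otherwise these two bounds are automatic.
    (hdeg₁ : (∀ x x' y, F x y = F x' y) → μ₁ ≤ L)
    (hdeg₂ : (∀ x y y', F x y = F x y') → μ₂ ≤ L)
    (x : ℕ → Minimax.Vec n) (y : ℕ → Minimax.Vec m)
    (hxy : Minimax.IsAltGDA F (μ₂ ^ 2 / (18 * L ^ 3)) (1 / L) x y)
    (L_h M : ℝ)
    (hLh : L_h = L + L ^ 2 / (2 * μ₂))
    (hM : M = max (2 * L_h ^ 2 / μ₁) (40 * L ^ 2 / μ₂))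
    (k : ℕ) (hk : 1 ≤ k) :
    ‖Minimax.gradX F (x k) (y k)‖ ^ 2 + ‖Minimax.gradY F (x k) (y k)‖ ^ 2 ≤
      Minimax.potential F (1 / 10) (x 0) (y 0) * M *
        (1 - μ₁ * μ₂ ^ 2 / (36 * L ^ 3)) ^ k := by
  have hL0 := hL.pos
  have hμ₁ := hPL.pos₁
  have hμ₂ := hPL.pos₂
  have hμL₁ := Minimax.mu₁_le hL hS hPL hdeg₁
  have hμL₂ := Minimax.mu₂_le hL hS hPL hdeg₂
  obtain ⟨j, rfl⟩ : ∃ j, k = j + 1 := ⟨k - 1, by omega⟩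
  set ρ := 1 - μ₁ * μ₂ ^ 2 / (36 * L ^ 3) with hρ
  have hu0 : 0 < μ₂ / L := by positivity
  have hu1 : μ₂ / L ≤ 1 := (div_le_one hL0).2 hμL₂
  have hρ0 : 0 ≤ ρ := by
    rw [hρ, sub_nonneg, div_le_one (by positivity)]
    have h1 : μ₁ * μ₂ ^ 2 ≤ L * L ^ 2 :=
      mul_le_mul hμL₁ (pow_le_pow_left₀ hμ₂.le hμL₂ 2) (by positivity) hL0.le
    have h2 : 0 < L ^ 3 := by positivity
    linarith
  have hcontr : ∀ i, Minimax.potential F (1 / 10) (x i) (y i) ≤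
      ρ ^ i * Minimax.potential F (1 / 10) (x 0) (y 0) := by
    intro i
    induction i with
    | zero => simp
    | succ i ih =>
      refine (Minimax.potential_step_le_mul_potential hL hS hPL hμL₂ (by norm_num) hμL₁
        (by linarith) (by linarith) (hxy.step_x i) (hxy.step_y i)).trans ?_
      rw [pow_succ' ρ, mul_assoc]
      exact mul_le_mul_of_nonneg_left ih hρ0
  -- This weight is the gap coefficient `(25/9)L²/μ₂ + 2L` of the gradient bound divided by
  -- `40L²/μ₂`.
  have hlast := Minimax.potential_step_le_mul_potential (lam := 25 / 360 + μ₂ / L / 20) hL hS hPL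
    hμL₂ (by positivity) hμL₁ (by nlinarith) (by nlinarith [sq_nonneg (μ₂ / L - 1 / 2)])
    (hxy.step_x j) (hxy.step_y j)
  have hP := Minimax.potential_nonneg hS (by norm_num : (0 : ℝ) ≤ 1 / 10) (x 0) (y 0)
  calc _ ≤ 40 * L ^ 2 / μ₂ *
        Minimax.potential F (25 / 360 + μ₂ / L / 20) (x (j + 1)) (y (j + 1)) :=
        Minimax.gradient_sq_add_le hL hS hPL hμL₂ _ _
    _ ≤ 40 * L ^ 2 / μ₂ * (ρ ^ (j + 1) * Minimax.potential F (1 / 10) (x 0) (y 0)) := by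
        refine mul_le_mul_of_nonneg_left (hlast.trans ?_) (by positivity)
        rw [pow_succ' ρ, mul_assoc]
        exact mul_le_mul_of_nonneg_left (hcontr j) hρ0
    _ ≤ M * (ρ ^ (j + 1) * Minimax.potential F (1 / 10) (x 0) (y 0)) :=
        mul_le_mul_of_nonneg_right (hM ▸ le_max_right _ _) (by positivity)
    _ = _ := by ring
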